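/- Let $(\Omega,\beta,\mu)$ be a finite measure space, let $X$ be a reflexive Banach space, and let $\tau:\Omega\to\Omega$ be an endomorphism, that is, a measurable map with $\mu(\tau^{-1}A)=\mu(A)$ for all $A\in\beta$. Put $Tf=f\circ\tau$ and $S_nf=\frac1n\sum_{i=0}^{n-1}T^if$ for $n\ge1$. Let $(F_n)$ be a sequence of $\sigma$-subalgebras of $\beta$ which either increases, with $F_\infty$ the $\sigma$-algebra generated by $\bigcup_nF_n$, or decreases, with $F_\infty=\bigcap_nF_n$. Let $1\le p<\infty$, and let $f\in L_p(\Omega,X)$, the space of (classes of) strongly measurable $X$-valued functions with $\|f\|_p=\left(\int_\Omega\|f\|_X^p\,d\mu\right)^{1/p}<\infty$. Write $E(\cdot\mid F)$ for the conditional expectation given $F$. Then the limit $f^*=\lim_{n\to\infty}S_nf$ exists in the norm of $L_p(\Omega,X)$ and almost everywhere, and the following hold. 1. $E(S_{n_1}f\mid F_{n_2})\to E(f^*\mid F_\infty)$ in the norm of $L_p(\Omega,X)$ as $n_1,n_2\to\infty$ independently. Moreover, $\|E(f^*\mid F_\infty)\|_p\le\|f\|_p$. 2. If $\sup_{n\ge1}\|S_nf\|_X$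 is integrable, then $E(S_{n_1}f\mid F_{n_2})\to E(f^*\mid F_\infty)$ almost everywhere and in the norm of $L_1(\Omega,X)$ as $n_1,n_2\to\infty$ independently. Moreover, $\int_\Omega E(f^*\mid F_\infty)\,d\mu=\int_\Omega f\,d\mu$. -/

import Mathlib

open MeasureTheory Filter
open scoped Topology ENNReal

/-- A real normed space is reflexive if the canonical embedding into its topological bidual
is onto. -/
def IsReflexiveSpace (X : Type*) [NormedAddCommGroup X] [NormedSpace ℝ X] : Prop :=
  Function.Surjective (NormedSpace.inclusionInDoubleDual ℝ X)

/-- `F n ↑ G` or `F n ↓ G`: the sequence of σ-algebras is increasing and `G` is the σ-algebra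
generated by all of them, or it is decreasing and `G` is their intersection. -/
def MonotoneSigmaLimit {Ω : Type*} (F : ℕ → MeasurableSpace Ω) (G : MeasurableSpace Ω) : Prop :=
  (Monotone F ∧ G = ⨆ n, F n) ∨ (Antitone F ∧ G = ⨅ n, F n)

/-! The averages `S_n` and the conditional expectations are contractions of `L_p`, so norm
convergence need only be checked on indicators `1_s c`. These reduce to scalar functions with values
in `[0, 1]`, where `L_1` convergence already gives `L_p` convergence. There the averages converge by
von Neumann's theorem in `L_2`, the conditional expectations by Lévy's upward theorem or, along a
decreasing sequence, by convergence of orthogonal projections.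

Almost everywhere convergence follows from norm convergence by Banach's principle: it suffices to
dominate the eventual error by functions of arbitrarily small weak `L_1` size. The bounds come from
the maximal ergodic inequality, from Doob's inequality in reversed time, and, along an increasing
sequence, from the scalar martingale `E(‖w‖ | F_n)`.

For the double limit, the error is split as `E(S_{n₁}f - f* | F_{n₂}) + (E(f* | F_{n₂}) - E(f* |
F_∞))`. In norm the first term is at most `‖S_{n₁}f - f*‖_p`, uniformly in `n₂`. Pointwise, for `n₁
≥ N`, it is at most `E(H_N | F_{n₂})` with `H_N = sup_{n ≥ N} ‖S_n f - f*‖`. An integrable supremum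
gives `∫ H_N → 0` by dominated convergence, and Banach's principle applies again. -/

/-! ### Banach's principle, density, and comparison of `L_1` with `L_p`. -/

/-- A form of Banach's principle. -/
theorem ae_tendsto_of_weak_bound {Ω E ι : Type*} {m0 : MeasurableSpace Ω} {μ : Measure Ω}
    [NormedAddCommGroup E] {l : Filter ι} {u : ι → Ω → E} {g : Ω → E}
    (h : ∀ ε : ℝ≥0∞, ε ≠ 0 → ∃ M : Ω → ℝ≥0∞,
      (∀ᵐ ω ∂μ, ∀ δ : ℝ≥0∞, δ ≠ 0 → ∀ᶠ i in l, ‖u i ω - g ω‖ₑ ≤ M ω + δ) ∧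
      ∀ c : ℝ≥0∞, c ≠ ∞ → c * μ {ω | c < M ω} ≤ ε) :
    ∀ᵐ ω ∂μ, Tendsto (fun i => u i ω) l (𝓝 (g ω)) := by
  have key : ∀ k : ℕ, ∀ᵐ ω ∂μ, ∀ᶠ i in l,
      ‖u i ω - g ω‖ₑ ≤ ((k + 1 : ℕ) : ℝ≥0∞)⁻¹ + ((k + 1 : ℕ) : ℝ≥0∞)⁻¹ := by
    intro k
    set c : ℝ≥0∞ := ((k + 1 : ℕ) : ℝ≥0∞)⁻¹ with hc
    have hc0 : c ≠ 0 := ENNReal.inv_ne_zero.2 (ENNReal.natCast_ne_top _)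
    have hct : c ≠ ∞ := ENNReal.inv_ne_top.2 (by simp)
    rw [ae_iff]
    by_contra hpos
    set B := {ω | ¬ ∀ᶠ i in l, ‖u i ω - g ω‖ₑ ≤ c + c} with hB
    -- A set `B` of positive measure leaves room for `0 < ε < c * μ B`, which the weak bound for
    -- this `ε` contradicts.
    obtain ⟨ε, hε0, hε⟩ := exists_between (pos_iff_ne_zero.2 (mul_ne_zero hc0 hpos))
    obtain ⟨M, hM, hMc⟩ := h ε hε0.ne'
    have hle : μ B ≤ μ {ω | c < M ω} := by
      refine measure_mono_ae ?_
      filter_upwards [hM] with ω hω hωB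
      by_contra hlt
      refine hωB ((hω c hc0).mono fun i hi => hi.trans ?_)
      gcongr
      exact not_lt.1 hlt
    exact absurd ((mul_le_mul_right hle c).trans (hMc c hct)) (not_le.2 hε)
  filter_upwards [ae_all_iff.2 key] with ω hω
  rw [tendsto_iff_edist_tendsto_0, ENNReal.tendsto_nhds_zero]
  intro ε hε
  obtain ⟨k, hk⟩ := ENNReal.exists_inv_nat_lt (ENNReal.half_pos hε.ne').ne'
  filter_upwards [hω k] with i hi
  rw [edist_eq_enorm_sub]
  have h2 : ((k + 1 : ℕ) : ℝ≥0∞)⁻¹ ≤ ε / 2 :=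
    (ENNReal.inv_le_inv.2 (by exact_mod_cast Nat.le_succ k)).trans hk.le
  calc _ ≤ _ := hi
    _ ≤ ε / 2 + ε / 2 := add_le_add h2 h2
    _ = ε := ENNReal.add_halves ε

/-- Convergence to zero of uniformly bounded subadditive functionals on `L_p` follows from
convergence on indicators. -/
theorem tendsto_zero_of_tendsto_zero_indicator {Ω E ι : Type*} {m0 : MeasurableSpace Ω}
    {μ : Measure Ω} [IsFiniteMeasure μ] [NormedAddCommGroup E] {p : ℝ≥0∞} (hp_top : p ≠ ∞)
    {l : Filter ι} {N : ι → (Ω → E) → ℝ≥0∞} {C : ℝ≥0∞} (hC : C ≠ ∞)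
    (hadd : ∀ i f g, MemLp f p μ → MemLp g p μ → N i (f + g) ≤ N i f + N i g)
    (hbd : ∀ i f, MemLp f p μ → N i f ≤ C * eLpNorm f p μ)
    (hind : ∀ s, MeasurableSet s → ∀ c : E, Tendsto (fun i => N i (s.indicator fun _ => c)) l (𝓝 0))
    {f : Ω → E} (hf : MemLp f p μ) : Tendsto (fun i => N i f) l (𝓝 0) := by
  rw [ENNReal.tendsto_nhds_zero]
  intro ε hε
  have hC1 : C + 1 ≠ ∞ := by finiteness
  -- Dividing by `C + 1` instead of `C` covers `C = 0`.
  have hη : ε / 2 / (C + 1) ≠ 0 :=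
    (ENNReal.div_pos (ENNReal.half_pos hε.ne').ne' hC1).ne'
  obtain ⟨g, hfg, hg, hgN⟩ := hf.induction_dense hp_top
    (fun g => MemLp g p μ ∧ Tendsto (fun i => N i g) l (𝓝 0))
    (fun c s hs _ η _ => ⟨s.indicator fun _ => c, by simp,
      memLp_indicator_const p hs c (Or.inr (measure_ne_top μ s)), hind s hs c⟩)
    (fun f g hf hg => ⟨hf.1.add hg.1, by
      have := hf.2.add hg.2
      rw [add_zero] at this
      exact tendsto_of_tendsto_of_tendsto_of_le_of_le tendsto_const_nhds this
        (fun _ => zero_le) (fun i => hadd i f g hf.1 hg.1)⟩)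
    (fun f hf => hf.1.1) hη
  filter_upwards [ENNReal.tendsto_nhds_zero.1 hgN (ε / 2) (ENNReal.half_pos hε.ne')] with i hi
  calc N i f = N i (g + (f - g)) := by rw [add_sub_cancel]
    _ ≤ N i g + N i (f - g) := hadd i _ _ hg (hf.sub hg)
    _ ≤ ε / 2 + C * (ε / 2 / (C + 1)) := by
        gcongr
        exact (hbd i _ (hf.sub hg)).trans (by gcongr)
    _ ≤ ε / 2 + (C + 1) * (ε / 2 / (C + 1)) := by gcongr; exact le_self_add
    _ = ε := by rw [ENNReal.mul_div_cancel (by simp) hC1, ENNReal.add_halves]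

/-- Pointwise `‖d‖ ^ p ≤ ‖d‖` when `‖d‖ ≤ 1` and `p ≥ 1`. -/
theorem eLpNorm_le_eLpNorm_one_rpow_of_enorm_le_one {Ω E : Type*} {m0 : MeasurableSpace Ω}
    {μ : Measure Ω} [NormedAddCommGroup E] {p : ℝ≥0∞} (hp : 1 ≤ p) (hp_top : p ≠ ∞)
    {d : Ω → E} (hd : ∀ᵐ ω ∂μ, ‖d ω‖ₑ ≤ 1) :
    eLpNorm d p μ ≤ (eLpNorm d 1 μ) ^ (1 / p.toReal) := by
  have hp0 : p ≠ 0 := (zero_lt_one.trans_le hp).ne'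
  rw [eLpNorm_eq_lintegral_rpow_enorm_toReal hp0 hp_top, eLpNorm_one_eq_lintegral_enorm]
  gcongr ?_ ^ _
  refine lintegral_mono_ae (hd.mono fun ω hω => ?_)
  exact ENNReal.rpow_le_self_of_le_one hω (by
    simpa using ENNReal.toReal_mono hp_top hp)

theorem tendsto_eLpNorm_of_enorm_le_one {Ω E ι : Type*} {m0 : MeasurableSpace Ω}
    {μ : Measure Ω} [NormedAddCommGroup E] {p : ℝ≥0∞} (hp : 1 ≤ p) (hp_top : p ≠ ∞)
    {l : Filter ι} {d : ι → Ω → E} (hd : ∀ i, ∀ᵐ ω ∂μ, ‖d i ω‖ₑ ≤ 1)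
    (h : Tendsto (fun i => eLpNorm (d i) 1 μ) l (𝓝 0)) :
    Tendsto (fun i => eLpNorm (d i) p μ) l (𝓝 0) := by
  have hp0 : p ≠ 0 := (zero_lt_one.trans_le hp).ne'
  have hpos : 0 < 1 / p.toReal := one_div_pos.2 (ENNReal.toReal_pos hp0 hp_top)
  have h2 := h.ennrpow_const (1 / p.toReal)
  rw [ENNReal.zero_rpow_of_pos hpos] at h2
  exact tendsto_of_tendsto_of_tendsto_of_le_of_le tendsto_const_nhds h2
    (fun _ => zero_le) (fun i => eLpNorm_le_eLpNorm_one_rpow_of_enorm_le_one hp hp_top (hd i))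

theorem tendsto_eLpNorm_one_of_tendsto_eLpNorm {Ω E ι : Type*} {m0 : MeasurableSpace Ω}
    {μ : Measure Ω} [IsFiniteMeasure μ] [NormedAddCommGroup E] {p : ℝ≥0∞} (hp : 1 ≤ p)
    {l : Filter ι} {d : ι → Ω → E} (hd : ∀ i, AEStronglyMeasurable (d i) μ)
    (h : Tendsto (fun i => eLpNorm (d i) p μ) l (𝓝 0)) :
    Tendsto (fun i => eLpNorm (d i) 1 μ) l (𝓝 0) := by
  have hK : μ Set.univ ^ (1 / (1 : ℝ≥0∞).toReal - 1 / p.toReal) ≠ ∞ := by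
    refine (ENNReal.rpow_lt_top_of_nonneg ?_ (measure_ne_top _ _)).ne
    rcases eq_or_ne p ∞ with rfl | hpt
    · simp
    · have : 1 ≤ p.toReal := by simpa using ENNReal.toReal_mono hpt hp
      simpa using inv_le_one_of_one_le₀ this
  have h2 := ENNReal.Tendsto.mul_const h (Or.inr hK)
  rw [zero_mul] at h2
  exact tendsto_of_tendsto_of_tendsto_of_le_of_le tendsto_const_nhds h2
    (fun _ => zero_le) (fun i => eLpNorm_le_eLpNorm_mul_rpow_measure_univ hp (hd i))

/-! ### Birkhoff averages as contractions of `L_p`. -/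

section BirkhoffAverage

variable {Ω E : Type*} {m0 : MeasurableSpace Ω} {μ : Measure Ω} [NormedAddCommGroup E]
  {τ : Ω → Ω}

theorem birkhoffSum_eq_sum_comp (τ : Ω → Ω) (f : Ω → E) (n : ℕ) :
    birkhoffSum τ f n = ∑ i ∈ Finset.range n, f ∘ τ^[i] := by
  ext ω; simp [birkhoffSum]

theorem MeasureTheory.MemLp.birkhoffSum (hτ : MeasurePreserving τ μ μ) {p : ℝ≥0∞} {f : Ω → E}
    (hf : MemLp f p μ) (n : ℕ) : MemLp (birkhoffSum τ f n) p μ := by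
  rw [birkhoffSum_eq_sum_comp]
  exact memLp_finsetSum' _ fun i _ => hf.comp_measurePreserving (hτ.iterate i)

variable [NormedSpace ℝ E]

theorem birkhoffAverage_eq_smul_birkhoffSum (τ : Ω → Ω) (f : Ω → E) (n : ℕ) :
    birkhoffAverage ℝ τ f n = (n : ℝ)⁻¹ • birkhoffSum τ f n := rfl

theorem MeasureTheory.MemLp.birkhoffAverage (hτ : MeasurePreserving τ μ μ) {p : ℝ≥0∞} {f : Ω → E}
    (hf : MemLp f p μ) (n : ℕ) : MemLp (birkhoffAverage ℝ τ f n) p μ :=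
  (hf.birkhoffSum hτ n).const_smul _

theorem eLpNorm_birkhoffAverage_le (hτ : MeasurePreserving τ μ μ) {p : ℝ≥0∞} (hp : 1 ≤ p)
    {f : Ω → E} (hf : AEStronglyMeasurable f μ) (n : ℕ) :
    eLpNorm (birkhoffAverage ℝ τ f n) p μ ≤ eLpNorm f p μ := by
  rcases eq_or_ne n 0 with rfl | hn
  · simp
  rw [birkhoffAverage_eq_smul_birkhoffSum, eLpNorm_const_smul, birkhoffSum_eq_sum_comp]
  have h1 : eLpNorm (∑ i ∈ Finset.range n, f ∘ τ^[i]) p μ ≤ n * eLpNorm f p μ := by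
    refine (eLpNorm_sum_le (fun i _ => hf.comp_measurePreserving (hτ.iterate i)) hp).trans ?_
    simp [eLpNorm_comp_measurePreserving hf (hτ.iterate _)]
  have h2 : ‖(n : ℝ)⁻¹‖ₑ = (n : ℝ≥0∞)⁻¹ := by
    rw [enorm_inv (by exact_mod_cast hn)]
    simp
  calc _ ≤ (n : ℝ≥0∞)⁻¹ * (n * eLpNorm f p μ) := by rw [h2]; gcongr
    _ = eLpNorm f p μ := by
      rw [← mul_assoc, ENNReal.inv_mul_cancel (by exact_mod_cast hn) (by simp), one_mul]

theorem norm_birkhoffAverage_le (τ : Ω → Ω) (f : Ω → E) (n : ℕ) (ω : Ω) :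
    ‖birkhoffAverage ℝ τ f n ω‖ ≤ birkhoffAverage ℝ τ (fun x => ‖f x‖) n ω := by
  simp only [birkhoffAverage, norm_smul, norm_inv, smul_eq_mul, birkhoffSum]
  rw [RCLike.norm_natCast]
  gcongr
  exact norm_sum_le _ _

theorem birkhoffAverage_indicator (τ : Ω → Ω) (s : Set Ω) (c : E) (n : ℕ) :
    birkhoffAverage ℝ τ (s.indicator fun _ => c) n =
      fun ω => birkhoffAverage ℝ τ (s.indicator fun _ => (1 : ℝ)) n ω • c := by
  ext ω
  simp only [birkhoffAverage, birkhoffSum, smul_assoc, Finset.sum_smul]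
  congr 1
  refine Finset.sum_congr rfl fun i _ => ?_
  by_cases h : τ^[i] ω ∈ s <;> simp [h]

theorem integral_comp_measurePreserving {σ : Ω → Ω} (hσ : MeasurePreserving σ μ μ) {f : Ω → E}
    (hf : AEStronglyMeasurable f μ) : ∫ ω, f (σ ω) ∂μ = ∫ ω, f ω ∂μ := by
  have h := integral_map (f := f) hσ.measurable.aemeasurable (by rwa [hσ.map_eq])
  rw [hσ.map_eq] at h
  exact h.symm

/-! ### The maximal ergodic inequality -/

/-- The maximum of `0` and the Birkhoff sums of `h` up to time `n`. -/
noncomputable def birkhoffMax (τ : Ω → Ω) (h : Ω → ℝ) : ℕ → Ω → ℝ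
  | 0 => 0
  | n + 1 => fun ω => max 0 (h ω + birkhoffMax τ h n (τ ω))

theorem birkhoffMax_nonneg (τ : Ω → Ω) (h : Ω → ℝ) (n : ℕ) (ω : Ω) : 0 ≤ birkhoffMax τ h n ω := by
  cases n
  · exact le_rfl
  · exact le_max_left _ _

theorem birkhoffMax_le_succ (τ : Ω → Ω) (h : Ω → ℝ) (n : ℕ) (ω : Ω) :
    birkhoffMax τ h n ω ≤ birkhoffMax τ h (n + 1) ω := by
  induction n generalizing ω with
  | zero => exact le_max_left _ _
  | succ n ih =>
    simp only [birkhoffMax] at ih ⊢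
    have := ih (τ ω)
    gcongr

theorem birkhoffSum_le_birkhoffMax (τ : Ω → Ω) (h : Ω → ℝ) (n : ℕ) (ω : Ω) :
    birkhoffSum τ h n ω ≤ birkhoffMax τ h n ω := by
  induction n generalizing ω with
  | zero => simp [birkhoffMax]
  | succ n ih =>
    rw [birkhoffSum_succ', birkhoffMax]
    exact le_max_of_le_right (by have := ih (τ ω); gcongr)

theorem integrable_birkhoffMax (hτ : MeasurePreserving τ μ μ) {h : Ω → ℝ} (hh : Integrable h μ)
    (n : ℕ) : Integrable (birkhoffMax τ h n) μ := by
  induction n with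
  | zero => exact integrable_zero _ _ _
  | succ n ih =>
    exact (integrable_zero _ _ _).sup (hh.add ((hτ.integrable_comp ih.1).2 ih))

/-- Garsia's argument. For `c ≥ 0` take `W = g - M + M ∘ τ`. Where `M > 0`, the recursion and
monotonicity in `n` give `M ≤ g - c + M ∘ τ`, so `W ≥ c`; where `M = 0`, `W = g + M ∘ τ ≥ 0`.
Invariance of `μ` gives `∫ W = ∫ g`, and Markov's inequality finishes. -/
theorem mul_measureReal_birkhoffMax_pos_le [IsFiniteMeasure μ] (hτ : MeasurePreserving τ μ μ)
    {g : Ω → ℝ} (hg : Integrable g μ) (hg0 : ∀ ω, 0 ≤ g ω) {c : ℝ} (n : ℕ) :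
    c * μ.real {ω | 0 < birkhoffMax τ (fun x => g x - c) n ω} ≤ ∫ ω, g ω ∂μ := by
  set M := birkhoffMax τ (fun x => g x - c) n with hM
  rcases le_total c 0 with hc | hc
  · exact (mul_nonpos_of_nonpos_of_nonneg hc measureReal_nonneg).trans (integral_nonneg hg0)
  have hMi : Integrable M μ := integrable_birkhoffMax hτ (hg.sub (integrable_const c)) n
  have hMτ : Integrable (fun ω => M (τ ω)) μ := (hτ.integrable_comp hMi.1).2 hMi
  have hM0 : ∀ ω, 0 ≤ M ω := birkhoffMax_nonneg _ _ _
  set W : Ω → ℝ := fun ω => g ω - M ω + M (τ ω) with hW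
  have hWi : Integrable W μ := (hg.sub hMi).add hMτ
  have hpos : ∀ ω, 0 < M ω → c ≤ W ω := by
    intro ω hω
    cases n with
    | zero => simp [hM, birkhoffMax] at hω
    | succ n =>
      have h1 : M ω = g ω - c + birkhoffMax τ (fun x => g x - c) n (τ ω) := by
        rw [hM, birkhoffMax] at hω ⊢
        exact max_eq_right_of_lt ((lt_max_iff.1 hω).resolve_left (lt_irrefl _))
      have h2 := birkhoffMax_le_succ τ (fun x => g x - c) n (τ ω)
      have h3 : W ω = g ω - M ω + M (τ ω) := rfl
      linarith
  have hW0 : ∀ ω, 0 ≤ W ω := by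
    intro ω
    rcases (hM0 ω).eq_or_lt with h | h
    · have h3 : W ω = g ω - M ω + M (τ ω) := rfl
      rw [h3, ← h]
      linarith [hg0 ω, hM0 (τ ω)]
    · exact hc.trans (hpos ω h)
  calc _ ≤ c * μ.real {ω | c ≤ W ω} := by
        refine mul_le_mul_of_nonneg_left (measureReal_mono (fun ω hω => ?_)) hc
        exact hpos ω hω
    _ ≤ ∫ ω, W ω ∂μ := mul_meas_ge_le_integral_of_nonneg (ae_of_all _ hW0) hWi c
    _ = ∫ ω, g ω ∂μ := by
      have : ∫ ω, M (τ ω) ∂μ = ∫ ω, M ω ∂μ := integral_comp_measurePreserving hτ hMi.1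
      rw [hW, integral_add (f := fun ω => g ω - M ω) (hg.sub hMi) hMτ, integral_sub hg hMi, this]
      ring

/-- The maximal ergodic inequality for functions with values in a normed space. -/
theorem mul_measure_iSup_enorm_birkhoffAverage_le [IsFiniteMeasure μ]
    (hτ : MeasurePreserving τ μ μ) {f : Ω → E} (hf : MemLp f 1 μ) {c : ℝ≥0∞} (hc : c ≠ ∞) :
    c * μ {ω | c < ⨆ n, ‖birkhoffAverage ℝ τ f n ω‖ₑ} ≤ eLpNorm f 1 μ := by
  lift c to NNReal using hc
  have hfi : Integrable f μ := memLp_one_iff_integrable.1 hf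
  set B : ℕ → Set Ω := fun n => {ω | 0 < birkhoffMax τ (fun x => ‖f x‖ - c) n ω} with hB
  have hBm : Monotone B := monotone_nat_of_le_succ fun n ω (hω : 0 < _) =>
    hω.trans_le (birkhoffMax_le_succ _ _ n ω)
  have hsub : {ω | (c : ℝ≥0∞) < ⨆ n, ‖birkhoffAverage ℝ τ f n ω‖ₑ} ⊆ ⋃ n, B n := by
    intro ω hω
    obtain ⟨n, hn⟩ := lt_iSup_iff.1 (Set.mem_ofPred_eq ▸ hω)
    have hn' : (c : ℝ) < ‖birkhoffAverage ℝ τ f n ω‖ := by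
      rw [enorm_eq_nnnorm] at hn
      exact_mod_cast hn
    refine Set.mem_iUnion.2 ⟨n, lt_of_lt_of_le ?_ (birkhoffSum_le_birkhoffMax _ _ n ω)⟩
    -- The average at `n = 0` is `0`, hence cannot exceed `c`.
    have hn0 : n ≠ 0 := by
      rintro rfl
      simp at hn
    have h1 := hn'.trans_le (norm_birkhoffAverage_le τ f n ω)
    rw [birkhoffAverage, smul_eq_mul, lt_inv_mul_iff₀ (by positivity)] at h1
    simp only [birkhoffSum, Finset.sum_sub_distrib, Finset.sum_const, Finset.card_range,
      nsmul_eq_mul] at h1 ⊢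
    linarith
  refine (mul_le_mul_right (measure_mono hsub) _).trans ?_
  rw [hBm.measure_iUnion, ENNReal.mul_iSup]
  refine iSup_le fun n => ?_
  have h := mul_measureReal_birkhoffMax_pos_le hτ hfi.norm (fun _ => norm_nonneg _) (c := c) n
  rw [eLpNorm_one_eq_lintegral_enorm, ← ofReal_integral_norm_eq_lintegral_enorm hfi]
  refine le_trans (le_of_eq ?_) (ENNReal.ofReal_le_ofReal h)
  rw [ENNReal.ofReal_mul c.coe_nonneg, ofReal_measureReal, ENNReal.ofReal_coe_nnreal]

/-! ### The mean ergodic theorem -/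

/-- Composition with `τ` is an isometry of the Hilbert space `L_2`, so von Neumann's theorem
applies; the rest matches operator averages with averages of functions. -/
theorem exists_tendsto_eLpNorm_two_birkhoffAverage (hτ : MeasurePreserving τ μ μ) {f : Ω → ℝ}
    (hf : MemLp f 2 μ) : ∃ g : Ω → ℝ, MemLp g 2 μ ∧
      Tendsto (fun n => eLpNorm (birkhoffAverage ℝ τ f n - g) 2 μ) atTop (𝓝 0) := by
  set T : Lp ℝ 2 μ →L[ℝ] Lp ℝ 2 μ :=
    (Lp.compMeasurePreservingₗᵢ ℝ τ hτ).toContinuousLinearMap with hT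
  have hT1 : ‖T‖ ≤ 1 := LinearIsometry.norm_toContinuousLinearMap_le _
  have hiter : ∀ k, (T^[k]) (hf.toLp f) =
      (hf.comp_measurePreserving (hτ.iterate k)).toLp (f ∘ τ^[k]) := by
    intro k
    induction k with
    | zero => rfl
    | succ k ih => rw [Function.iterate_succ_apply', ih]; rfl
  have hsum : ∀ n, birkhoffSum T _root_.id n (hf.toLp f) = (hf.birkhoffSum hτ n).toLp _ := by
    intro n
    induction n with
    | zero => exact (MemLp.toLp_zero (hf.birkhoffSum hτ 0)).symm
    | succ n ih =>
      rw [birkhoffSum_succ, ih, id, hiter, ← MemLp.toLp_add]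
      congr 1
      ext ω
      exact (birkhoffSum_succ τ f n ω).symm
  have hav : ∀ n, birkhoffAverage ℝ T _root_.id n (hf.toLp f) =
      (hf.birkhoffAverage hτ n).toLp _ := by
    intro n
    rw [birkhoffAverage, hsum, ← MemLp.toLp_const_smul]
    rfl
  have h := T.tendsto_birkhoffAverage_orthogonalProjection hT1 (hf.toLp f)
  obtain ⟨G, h⟩ : ∃ G : Lp ℝ 2 μ,
      Tendsto (birkhoffAverage ℝ T _root_.id · (hf.toLp f)) atTop (𝓝 G) := ⟨_, h⟩
  refine ⟨G, Lp.memLp G, ?_⟩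
  rw [Lp.tendsto_Lp_iff_tendsto_eLpNorm'] at h
  refine h.congr fun n => eLpNorm_congr_ae ?_
  rw [hav]
  exact (hf.birkhoffAverage hτ n).coeFn_toLp.sub (ae_eq_refl _)

/-- The Cauchy form names no limit, so it is a statement about subadditive functionals and passes
from indicators to all of `L_p` by density. On indicators the averages lie in `[0, 1]`, and `L_2`
convergence passes to `L_1` and then to `L_p`. -/
theorem tendsto_eLpNorm_birkhoffAverage_sub_birkhoffAverage [IsFiniteMeasure μ]
    (hτ : MeasurePreserving τ μ μ) {p : ℝ≥0∞} (hp : 1 ≤ p) (hp_top : p ≠ ∞) {f : Ω → E}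
    (hf : MemLp f p μ) :
    Tendsto (fun n : ℕ × ℕ => eLpNorm (birkhoffAverage ℝ τ f n.1 - birkhoffAverage ℝ τ f n.2) p μ)
      atTop (𝓝 0) := by
  refine tendsto_zero_of_tendsto_zero_indicator (μ := μ) hp_top (C := 2)
    (N := fun (n : ℕ × ℕ) f =>
      eLpNorm (birkhoffAverage ℝ τ f n.1 - birkhoffAverage ℝ τ f n.2) p μ)
    (by simp) ?_ ?_ ?_ hf
  · intro i f g hf hg
    simp only [birkhoffAverage_add, Pi.add_apply]
    rw [add_sub_add_comm]
    exact eLpNorm_add_le ((hf.birkhoffAverage hτ _).sub (hf.birkhoffAverage hτ _)).1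
      ((hg.birkhoffAverage hτ _).sub (hg.birkhoffAverage hτ _)).1 hp
  · intro i f hf
    refine (eLpNorm_sub_le (hf.birkhoffAverage hτ _).1 (hf.birkhoffAverage hτ _).1 hp).trans ?_
    rw [two_mul]
    exact add_le_add (eLpNorm_birkhoffAverage_le hτ hp hf.1 _)
      (eLpNorm_birkhoffAverage_le hτ hp hf.1 _)
  · intro s hs c
    set φ : Ω → ℝ := s.indicator fun _ => (1 : ℝ) with hφ
    have hφ2 : MemLp φ 2 μ := memLp_indicator_const 2 hs 1 (Or.inr (measure_ne_top μ s))
    obtain ⟨g, hg, hlim⟩ := exists_tendsto_eLpNorm_two_birkhoffAverage hτ hφ2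
    have hmeas : ∀ n, AEStronglyMeasurable (birkhoffAverage ℝ τ φ n) μ :=
      fun n => (hφ2.birkhoffAverage hτ n).1
    have h1 := tendsto_eLpNorm_one_of_tendsto_eLpNorm one_le_two
      (fun n => (hmeas n).sub hg.1) hlim
    have h01 : ∀ n ω, birkhoffAverage ℝ τ φ n ω ∈ Set.Icc (0 : ℝ) 1 := by
      intro n ω
      have hnn : ∀ x, φ x ∈ Set.Icc (0 : ℝ) 1 := fun x => by
        by_cases hx : x ∈ s <;> simp [hφ, hx]
      refine ⟨mul_nonneg (by positivity) (Finset.sum_nonneg fun i _ => (hnn _).1), ?_⟩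
      rw [birkhoffAverage, smul_eq_mul]
      refine inv_mul_le_one_of_le₀ ?_ (by positivity)
      simpa [birkhoffSum] using Finset.sum_le_card_nsmul (Finset.range n)
        (fun i => φ (τ^[i] ω)) 1 fun i _ => (hnn _).2
    have h2 : Tendsto (fun n : ℕ × ℕ =>
        eLpNorm (birkhoffAverage ℝ τ φ n.1 - birkhoffAverage ℝ τ φ n.2) 1 μ) atTop (𝓝 0) := by
      have := (h1.comp tendsto_fst).add (h1.comp tendsto_snd)
      rw [add_zero, prod_atTop_atTop_eq] at this
      refine tendsto_of_tendsto_of_tendsto_of_le_of_le tendsto_const_nhds this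
        (fun _ => zero_le) (fun n => ?_)
      rw [← sub_sub_sub_cancel_right _ _ g]
      exact eLpNorm_sub_le ((hmeas _).sub hg.1) ((hmeas _).sub hg.1) le_rfl
    have h3 := tendsto_eLpNorm_of_enorm_le_one (p := p) hp hp_top (fun n => ae_of_all _ fun ω => ?_) h2
    · have h4 := ENNReal.Tendsto.mul_const h3 (b := ‖c‖ₑ) (Or.inr enorm_ne_top)
      rw [zero_mul] at h4
      refine h4.congr fun n => ?_
      rw [birkhoffAverage_indicator τ s c n.1, birkhoffAverage_indicator τ s c n.2, mul_comm,
        ← eLpNorm_norm, ← eLpNorm_norm (f := _ - _)]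
      rw [← enorm_norm c, ← eLpNorm_const_smul]
      congr 1
      ext ω
      simp [← sub_smul, norm_smul, mul_comm, hφ]
    · have a := h01 n.1 ω
      have b := h01 n.2 ω
      rw [← ofReal_norm, ← ENNReal.ofReal_one]
      refine ENNReal.ofReal_le_ofReal ?_
      rw [Pi.sub_apply, Real.norm_eq_abs, abs_le]
      constructor <;> linarith [a.1, a.2, b.1, b.2]

/-- The mean ergodic theorem in `L_p` for functions with values in a Banach space. -/
theorem exists_tendsto_eLpNorm_birkhoffAverage [IsFiniteMeasure μ] [CompleteSpace E]
    (hτ : MeasurePreserving τ μ μ) {p : ℝ≥0∞} (hp : 1 ≤ p) (hp_top : p ≠ ∞) {f : Ω → E}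
    (hf : MemLp f p μ) : ∃ g : Ω → E, MemLp g p μ ∧
      Tendsto (fun n => eLpNorm (birkhoffAverage ℝ τ f n - g) p μ) atTop (𝓝 0) := by
  have : Fact (1 ≤ p) := ⟨hp⟩
  set u : ℕ → Lp E p μ := fun n => (hf.birkhoffAverage hτ n).toLp _ with hu
  have hc : CauchySeq u := by
    rw [cauchySeq_iff_tendsto, Metric.uniformity_eq_comap_nhds_zero]
    rw [tendsto_comap_iff]
    have h := tendsto_eLpNorm_birkhoffAverage_sub_birkhoffAverage hτ hp hp_top hf
    have h' := (ENNReal.tendsto_toReal ENNReal.zero_ne_top).comp h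
    refine h'.congr fun n => ?_
    simp only [Function.comp, hu, Prod.map]
    rw [dist_eq_norm, ← MemLp.toLp_sub, Lp.norm_toLp]
  obtain ⟨g, hg⟩ := cauchySeq_tendsto_of_complete hc
  refine ⟨g, Lp.memLp g, ?_⟩
  rw [Lp.tendsto_Lp_iff_tendsto_eLpNorm'] at hg
  exact hg.congr fun n => eLpNorm_congr_ae
    ((hf.birkhoffAverage hτ n).coeFn_toLp.sub (ae_eq_refl _))

/-- Telescoping gives `S_n f ∘ τ - S_n f = (f ∘ τ^n - f) / n`, of `L_1` norm at most `2‖f‖₁ / n`. -/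
theorem comp_ae_eq_of_tendsto_birkhoffAverage [IsFiniteMeasure μ]
    (hτ : MeasurePreserving τ μ μ) {f g : Ω → E} (hf : MemLp f 1 μ) (hg : MemLp g 1 μ)
    (h : Tendsto (fun n => eLpNorm (birkhoffAverage ℝ τ f n - g) 1 μ) atTop (𝓝 0)) :
    g ∘ τ =ᵐ[μ] g := by
  have hgτ := hg.comp_measurePreserving hτ
  have hdiff : Tendsto (fun n => eLpNorm
      (birkhoffAverage ℝ τ f n ∘ τ - birkhoffAverage ℝ τ f n) 1 μ) atTop (𝓝 0) := by
    have hK : (eLpNorm f 1 μ + eLpNorm f 1 μ) ≠ ∞ := by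
      simp [hf.2.ne]
    have h1 := ENNReal.Tendsto.mul_const ENNReal.tendsto_inv_nat_nhds_zero
      (b := eLpNorm f 1 μ + eLpNorm f 1 μ) (Or.inr hK)
    rw [zero_mul] at h1
    refine tendsto_of_tendsto_of_tendsto_of_le_of_le' tendsto_const_nhds h1
      (Eventually.of_forall fun _ => zero_le) ?_
    filter_upwards [eventually_ne_atTop 0] with n hn
    have heq : birkhoffAverage ℝ τ f n ∘ τ - birkhoffAverage ℝ τ f n =
        (n : ℝ)⁻¹ • (f ∘ τ^[n] - f) := by
      ext ω
      exact birkhoffAverage_apply_sub_birkhoffAverage τ f n ω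
    have h2 : ‖(n : ℝ)⁻¹‖ₑ = (n : ℝ≥0∞)⁻¹ := by
      rw [enorm_inv (by exact_mod_cast hn)]
      simp
    rw [heq, eLpNorm_const_smul, h2]
    gcongr
    refine (eLpNorm_sub_le (hf.1.comp_measurePreserving (hτ.iterate n)) hf.1 le_rfl).trans ?_
    rw [eLpNorm_comp_measurePreserving hf.1 (hτ.iterate n)]
  have hle : ∀ n, eLpNorm (g ∘ τ - g) 1 μ ≤ eLpNorm (birkhoffAverage ℝ τ f n - g) 1 μ +
      (eLpNorm (birkhoffAverage ℝ τ f n ∘ τ - birkhoffAverage ℝ τ f n) 1 μ +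
        eLpNorm (birkhoffAverage ℝ τ f n - g) 1 μ) := by
    intro n
    have hA := hf.birkhoffAverage hτ n
    have hAτ := hA.comp_measurePreserving hτ
    have e1 : eLpNorm (g ∘ τ - birkhoffAverage ℝ τ f n ∘ τ) 1 μ =
        eLpNorm (birkhoffAverage ℝ τ f n - g) 1 μ := by
      rw [eLpNorm_sub_comm (birkhoffAverage ℝ τ f n)]
      exact eLpNorm_comp_measurePreserving (hg.sub hA).1 hτ
    rw [← e1]
    have e2 : g ∘ τ - g = (g ∘ τ - birkhoffAverage ℝ τ f n ∘ τ) +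
        ((birkhoffAverage ℝ τ f n ∘ τ - birkhoffAverage ℝ τ f n) +
        (birkhoffAverage ℝ τ f n - g)) := by abel
    conv_lhs => rw [e2]
    refine (eLpNorm_add_le (hgτ.sub hAτ).1 ((hAτ.sub hA).add (hA.sub hg)).1 le_rfl).trans ?_
    rw [e1]
    gcongr
    exact eLpNorm_add_le (hAτ.sub hA).1 (hA.sub hg).1 le_rfl
  have h0 : eLpNorm (g ∘ τ - g) 1 μ = 0 := by
    have := h.add (hdiff.add h)
    simp only [add_zero] at this
    exact le_antisymm (ge_of_tendsto' this hle) zero_le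
  rw [eLpNorm_eq_zero_iff (hgτ.sub hg).1 one_ne_zero] at h0
  exact (sub_ae_eq_zero _ _).1 h0

theorem birkhoffAverage_ae_eq_of_comp_ae_eq (hτ : MeasurePreserving τ μ μ) {g : Ω → E}
    (h : g ∘ τ =ᵐ[μ] g) {n : ℕ} (hn : n ≠ 0) : birkhoffAverage ℝ τ g n =ᵐ[μ] g := by
  have hk : ∀ k, g ∘ τ^[k] =ᵐ[μ] g := by
    intro k
    induction k with
    | zero => rfl
    | succ k ih => exact (hτ.quasiMeasurePreserving.ae_eq_comp ih).trans h
  filter_upwards [ae_all_iff.2 hk] with ω hω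
  have : ∀ k, g (τ^[k] ω) = g ω := hω
  simp only [birkhoffAverage, birkhoffSum, this, Finset.sum_const, Finset.card_range]
  rw [← Nat.cast_smul_eq_nsmul ℝ, inv_smul_smul₀ (by exact_mod_cast hn)]

/-! ### The pointwise ergodic theorem. -/

/-- `S_n S_N f - S_n f` is the mean over `i < N` of `S_n f ∘ τ^i - S_n f`, and each of these
telescopes to zero at every point because `f` is bounded. -/
theorem tendsto_birkhoffAverage_birkhoffAverage_sub {f : Ω → E} (hf : ∃ C, ∀ ω, ‖f ω‖ ≤ C)
    {N : ℕ} (hN : N ≠ 0) (ω : Ω) :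
    Tendsto (fun n => birkhoffAverage ℝ τ (birkhoffAverage ℝ τ f N) n ω -
      birkhoffAverage ℝ τ f n ω) atTop (𝓝 0) := by
  obtain ⟨C, hC⟩ := hf
  have hstep : ∀ x, Tendsto (fun n => birkhoffAverage ℝ τ f n (τ x) - birkhoffAverage ℝ τ f n x)
      atTop (𝓝 0) := fun x => tendsto_birkhoffAverage_apply_sub_birkhoffAverage ℝ
    ((Metric.isBounded_closedBall (x := (0 : E)) (r := C)).subset (by
      rintro _ ⟨n, rfl⟩
      simpa using hC _))
  have hiter : ∀ i, Tendsto (fun n => birkhoffAverage ℝ τ f n (τ^[i] ω) -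
      birkhoffAverage ℝ τ f n ω) atTop (𝓝 0) := by
    intro i
    induction i with
    | zero => simp
    | succ i ih =>
      have := (hstep (τ^[i] ω)).add ih
      rw [add_zero] at this
      refine this.congr fun n => ?_
      rw [Function.iterate_succ_apply']
      abel
  have hs := (tendsto_finsetSum (Finset.range N) fun i _ => hiter i).const_smul (N : ℝ)⁻¹
  simp only [Finset.sum_const_zero, smul_zero] at hs
  refine hs.congr fun n => ?_
  have h1 : birkhoffAverage ℝ τ (birkhoffAverage ℝ τ f N) n ω =
      (N : ℝ)⁻¹ • ∑ i ∈ Finset.range N, birkhoffAverage ℝ τ f n (τ^[i] ω) := by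
    simp only [birkhoffAverage, birkhoffSum, ← Finset.smul_sum]
    rw [smul_comm, Finset.sum_comm]
    simp only [← Function.iterate_add_apply, add_comm]
  rw [h1, Finset.sum_sub_distrib, smul_sub, Finset.sum_const, Finset.card_range,
    ← Nat.cast_smul_eq_nsmul ℝ, inv_smul_smul₀ (by exact_mod_cast hN)]

/-- Birkhoff's pointwise ergodic theorem for functions with values in a normed space, given the
limit in mean. -/
theorem ae_tendsto_birkhoffAverage [IsFiniteMeasure μ]
    (hτ : MeasurePreserving τ μ μ) {f g : Ω → E} (hf : MemLp f 1 μ) (hg : MemLp g 1 μ)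
    (h : Tendsto (fun n => eLpNorm (birkhoffAverage ℝ τ f n - g) 1 μ) atTop (𝓝 0)) :
    ∀ᵐ ω ∂μ, Tendsto (fun n => birkhoffAverage ℝ τ f n ω) atTop (𝓝 (g ω)) := by
  have hinv := comp_ae_eq_of_tendsto_birkhoffAverage hτ hf hg h
  refine ae_tendsto_of_weak_bound fun ε hε => ?_
  have hε3 : ε / 3 ≠ 0 := (ENNReal.div_pos hε (by simp)).ne'
  obtain ⟨s, hs, hsm, hsb⟩ : ∃ s : Ω → E, eLpNorm (f - s) 1 μ < ε / 3 ∧ MemLp s 1 μ ∧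
      ∃ C, ∀ ω, ‖s ω‖ ≤ C := by
    obtain ⟨s, hs, hsm⟩ := hf.exists_simpleFunc_eLpNorm_sub_lt ENNReal.one_ne_top hε3
    exact ⟨s, hs, hsm, s.exists_forall_norm_le⟩
  obtain ⟨N, hN, hN0⟩ := ((ENNReal.tendsto_nhds_zero.1 h (ε / 3) (pos_iff_ne_zero.2 hε3)).and
    (eventually_ne_atTop 0)).exists
  -- Since `S_n g = g` almost everywhere, `S_n f - g = S_n w - (S_n S_N s - S_n s)`. The bracket
  -- tends to zero because `s` is bounded, and the maximal inequality controls `S_n w` by `‖w‖₁ ≤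
  -- ε`.
  set w : Ω → E := (f - s) + (birkhoffAverage ℝ τ s N - g) with hw
  have hAs := hsm.birkhoffAverage hτ N
  have hAf := hf.birkhoffAverage hτ N
  have hwm : MemLp w 1 μ := (hf.sub hsm).add (hAs.sub hg)
  have hwε : eLpNorm w 1 μ ≤ ε := by
    have e1 : w = (f - s) + (birkhoffAverage ℝ τ (s - f) N +
        (birkhoffAverage ℝ τ f N - g)) := by
      rw [hw, birkhoffAverage_sub, Pi.sub_apply]
      abel
    have hAd := (hsm.sub hf).birkhoffAverage hτ N
    calc eLpNorm w 1 μ ≤ eLpNorm (f - s) 1 μ + (eLpNorm (birkhoffAverage ℝ τ (s - f) N) 1 μ +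
          eLpNorm (birkhoffAverage ℝ τ f N - g) 1 μ) := by
          rw [e1]
          refine (eLpNorm_add_le (hf.sub hsm).1 (hAd.add (hAf.sub hg)).1 le_rfl).trans ?_
          gcongr
          exact eLpNorm_add_le hAd.1 (hAf.sub hg).1 le_rfl
      _ ≤ ε / 3 + (ε / 3 + ε / 3) := by
          gcongr
          refine (eLpNorm_birkhoffAverage_le hτ le_rfl (hsm.sub hf).1 N).trans ?_
          rw [eLpNorm_sub_comm]
          exact hs.le
      _ = ε := by rw [← add_assoc, ENNReal.add_thirds]
  refine ⟨fun ω => ⨆ n, ‖birkhoffAverage ℝ τ w n ω‖ₑ, ?_, fun c hc =>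
    (mul_measure_iSup_enorm_birkhoffAverage_le hτ hwm hc).trans hwε⟩
  have hall : ∀ᵐ ω ∂μ, ∀ n : ℕ, n ≠ 0 → birkhoffAverage ℝ τ g n ω = g ω := by
    rw [ae_all_iff]
    intro n
    rcases eq_or_ne n 0 with rfl | hn
    · simp
    · exact (birkhoffAverage_ae_eq_of_comp_ae_eq hτ hinv hn).mono fun ω hω _ => hω
  filter_upwards [hall] with ω hω δ hδ
  have hlim := tendsto_birkhoffAverage_birkhoffAverage_sub (τ := τ) hsb hN0 ω
  have hlim' := hlim.enorm
  rw [enorm_zero] at hlim'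
  filter_upwards [ENNReal.tendsto_nhds_zero.1 hlim' δ (pos_iff_ne_zero.2 hδ),
    eventually_ne_atTop 0] with n hn hn0
  have e : birkhoffAverage ℝ τ f n ω - g ω = birkhoffAverage ℝ τ w n ω -
      (birkhoffAverage ℝ τ (birkhoffAverage ℝ τ s N) n ω - birkhoffAverage ℝ τ s n ω) := by
    rw [hw, birkhoffAverage_add, birkhoffAverage_sub, birkhoffAverage_sub]
    simp only [Pi.add_apply, Pi.sub_apply, hω n hn0]
    abel
  rw [e]
  refine enorm_sub_le.trans (add_le_add ?_ hn)
  exact le_iSup (fun n => ‖birkhoffAverage ℝ τ w n ω‖ₑ) n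

theorem integral_birkhoffAverage (hτ : MeasurePreserving τ μ μ) {f : Ω → E} (hf : MemLp f 1 μ)
    {n : ℕ} (hn : n ≠ 0) : ∫ ω, birkhoffAverage ℝ τ f n ω ∂μ = ∫ ω, f ω ∂μ := by
  have hcomp : ∀ i, Integrable (fun ω => f (τ^[i] ω)) μ := fun i =>
    memLp_one_iff_integrable.1 (hf.comp_measurePreserving (hτ.iterate i))
  simp only [birkhoffAverage, birkhoffSum]
  rw [integral_smul, integral_finsetSum _ fun i _ => hcomp i]
  simp only [integral_comp_measurePreserving (hτ.iterate _) hf.1, Finset.sum_const,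
    Finset.card_range]
  rw [← Nat.cast_smul_eq_nsmul ℝ, inv_smul_smul₀ (by exact_mod_cast hn)]

end BirkhoffAverage

/-! ### Conditional expectations along a monotone sequence of σ-algebras. -/

/-- The `limsup` of the `F n`-measurable versions is unchanged when the first `k` terms are dropped,
so it is `F k`-measurable for every `k`. -/
theorem aestronglyMeasurable_iInf_of_antitone {Ω : Type*} {m0 : MeasurableSpace Ω}
    {μ : Measure Ω} {F : ℕ → MeasurableSpace Ω} (hanti : Antitone F) {g : Ω → ℝ} (hg : ∀ n, AEStronglyMeasurable[F n] g μ) :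
    AEStronglyMeasurable[⨅ n, F n] g μ := by
  refine ⟨fun ω => limsup (fun n => (hg n).mk g ω) atTop, Measurable.stronglyMeasurable ?_, ?_⟩
  · intro s hs
    refine MeasurableSpace.measurableSet_iInf.2 fun k => ?_
    have heq : (fun ω => limsup (fun n => (hg n).mk g ω) atTop) =
        fun ω => limsup (fun n => (hg (n + k)).mk g ω) atTop := by
      ext ω
      conv_lhs => rw [limsup, ← map_add_atTop_eq_nat k, Filter.map_map]
      rfl
    rw [heq]
    exact Measurable.limsup (fun n => ((hg (n + k)).stronglyMeasurable_mk.mono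
      (hanti (Nat.le_add_left k n))).measurable) hs
  · filter_upwards [ae_all_iff.2 fun n => (hg n).ae_eq_mk] with ω hω
    have hc : (fun n => (hg n).mk g ω) = fun _ => g ω := funext fun n => (hω n).symm
    rw [hc, limsup_const]

section ConditionalExpectation

variable {Ω E : Type*} {m0 : MeasurableSpace Ω} {μ : Measure Ω} [IsFiniteMeasure μ]
  [NormedAddCommGroup E] [NormedSpace ℝ E] [CompleteSpace E]
  {F : ℕ → MeasurableSpace Ω} {G : MeasurableSpace Ω}

theorem MonotoneSigmaLimit.le (h : MonotoneSigmaLimit F G) (hF : ∀ n, F n ≤ m0) : G ≤ m0 := by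
  rcases h with ⟨_, rfl⟩ | ⟨_, rfl⟩
  · exact iSup_le hF
  · exact (iInf_le F 0).trans (hF 0)

theorem condExp_indicator_const_ae_eq_smul (m : MeasurableSpace Ω) {s : Set Ω}
    (hs : MeasurableSet[m0] s) (c : E) : μ[s.indicator fun _ => c | m] =ᵐ[μ]
      fun ω => (μ[s.indicator fun _ => (1 : ℝ) | m]) ω • c := by
  have hi : Integrable (s.indicator fun _ => (1 : ℝ)) μ := (integrable_const 1).indicator hs
  have h := (ContinuousLinearMap.toSpanSingleton ℝ c).comp_condExp_comm (m := m) hi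
  refine EventuallyEq.trans (ae_of_all _ fun ω => ?_) h.symm
  congr 2
  ext x
  by_cases hx : x ∈ s <;> simp [hx]

/-- The maximal inequality for martingales with values in a Banach space, indexed by a decreasing
sequence of σ-algebras. -/
theorem mul_measure_iSup_enorm_condExp_le_of_antitone (hF : ∀ n, F n ≤ m0) (hanti : Antitone F)
    {f : Ω → E} (hf : Integrable f μ) {c : ℝ≥0∞} (hc : c ≠ ∞) :
    c * μ {ω | c < ⨆ n, ‖(μ[f | F n]) ω‖ₑ} ≤ eLpNorm f 1 μ := by
  lift c to NNReal using hc
  -- The positive part makes `Y` nonnegative everywhere, as Doob's inequality requires; the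
  -- conditional expectation is nonnegative only almost everywhere.
  set Y : ℕ → Ω → ℝ := fun n => (μ[fun x => ‖f x‖ | F n])⁺ with hY
  set B : ℕ → Set Ω := fun N => {ω | ∃ j ≤ N, (c : ℝ) ≤ Y j ω} with hB
  have hBm : Monotone B := fun N N' h ω ⟨j, hj, hω⟩ => ⟨j, hj.trans h, hω⟩
  have hsub : μ {ω | (c : ℝ≥0∞) < ⨆ n, ‖(μ[f | F n]) ω‖ₑ} ≤ μ (⋃ N, B N) := by
    refine measure_mono_ae ?_
    filter_upwards [ae_all_iff.2 fun n => norm_condExp_le (m := F n) (μ := μ) f] with ω hω hωc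
    obtain ⟨n, hn⟩ : ∃ n, (c : ℝ≥0∞) < ‖(μ[f | F n]) ω‖ₑ := lt_iSup_iff.1 hωc
    have hn' : (c : ℝ) < ‖(μ[f | F n]) ω‖ := by
      rw [enorm_eq_nnnorm] at hn
      exact_mod_cast hn
    exact Set.mem_iUnion.2 ⟨n, n, le_rfl, (hn'.le.trans (hω n)).trans (le_max_left _ _)⟩
  refine (mul_le_mul_right hsub _).trans ?_
  rw [hBm.measure_iUnion, ENNReal.mul_iSup]
  refine iSup_le fun N => ?_
  -- Reversing time on `{0, …, N}` gives an increasing filtration, to which Doob's inequality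
  -- applies with a bound independent of `N`.
  let 𝒢 : Filtration ℕ m0 :=
    { seq := fun k => F (N - k)
      mono' := fun i j hij => hanti (Nat.sub_le_sub_left hij N)
      le' := fun k => hF _ }
  have hsubm : Submartingale (fun k => Y (N - k)) 𝒢 μ :=
    (martingale_condExp (fun x => ‖f x‖) 𝒢 μ).submartingale.pos
  have hmax := maximal_ineq hsubm (fun k ω => le_max_right _ _) (ε := c) N
  have hBs : B N ⊆ {ω | (c : ℝ) ≤ (Finset.range (N + 1)).sup' Finset.nonempty_range_add_one
      fun k => Y (N - k) ω} := by
    rintro ω ⟨j, hj, hω⟩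
    rw [Set.mem_ofPred_eq, Finset.le_sup'_iff]
    exact ⟨N - j, by simp, by rwa [Nat.sub_sub_self hj]⟩
  refine (mul_le_mul_right (measure_mono hBs) _).trans (hmax.trans ?_)
  rw [eLpNorm_one_eq_lintegral_enorm, ← ofReal_integral_norm_eq_lintegral_enorm hf]
  refine ENNReal.ofReal_le_ofReal ?_
  refine (setIntegral_le_integral (hsubm.integrable N)
    (ae_of_all _ fun ω => le_max_right _ _)).trans (le_of_eq ?_)
  rw [← integral_condExp (hF (N - N)) (f := fun x => ‖f x‖)]
  refine integral_congr_ae ?_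
  filter_upwards [condExp_nonneg (μ := μ) (m := F (N - N)) (f := fun x => ‖f x‖)
    (ae_of_all _ fun x => norm_nonneg _)] with ω hω
  exact max_eq_left hω

/-- In `L_2` these are projections onto decreasing closed subspaces, which converge because the
projections onto the increasing complements do. The limit `v` lies in every subspace, so it is
measurable for the intersection `G`; then `E(f | G) - v = E(E(f | F n) - v | G)` has `L_1` norm
tending to zero. -/
theorem tendsto_eLpNorm_one_condExp_of_antitone (hF : ∀ n, F n ≤ m0) (hanti : Antitone F)
    {f : Ω → ℝ} (hf : MemLp f 2 μ) :
    Tendsto (fun n => eLpNorm (μ[f | F n] - μ[f | ⨅ n, F n]) 1 μ) atTop (𝓝 0) := by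
  have hG : (⨅ n, F n) ≤ m0 := (iInf_le F 0).trans (hF 0)
  have hfact : ∀ n, Fact (F n ≤ m0) := fun n => ⟨hF n⟩
  set U : ℕ → Submodule ℝ (Lp ℝ 2 μ) := fun n => lpMeas ℝ ℝ (F n) 2 μ with hU
  have hUc : ∀ n, CompleteSpace (U n) := fun n => inferInstanceAs
    (CompleteSpace (lpMeas ℝ ℝ (F n) 2 μ))
  have hUanti : Antitone U := fun i j hij v hv =>
    mem_lpMeas_iff_aestronglyMeasurable.2
      ((mem_lpMeas_iff_aestronglyMeasurable.1 hv).mono (hanti hij))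
  set x : Lp ℝ 2 μ := hf.toLp f with hx
  obtain ⟨v, hv⟩ : ∃ v, Tendsto (fun n => (U n).starProjection x) atTop (𝓝 v) := by
    have h := Submodule.starProjection_tendsto_closure_iSup (fun n => (U n)ᗮ)
      (fun i j hij => Submodule.orthogonal_le (hUanti hij)) x
    refine ⟨_, (tendsto_const_nhds (x := x)).sub h |>.congr fun n => ?_⟩
    simp [Submodule.starProjection_orthogonal']
  have hvU : ∀ k, v ∈ U k := fun k => by
    have hcl : IsClosed (U k : Set (Lp ℝ 2 μ)) :=
      (completeSpace_coe_iff_isComplete.1 (hUc k)).isClosed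
    refine hcl.mem_of_tendsto hv ?_
    filter_upwards [eventually_ge_atTop k] with n hn
    exact hUanti hn (Submodule.starProjection_apply_mem _ _)
  have hvm : AEStronglyMeasurable[⨅ n, F n] v μ := aestronglyMeasurable_iInf_of_antitone hanti
    fun n => mem_lpMeas_iff_aestronglyMeasurable.1 (hvU n)
  have hvi : Integrable v μ := memLp_one_iff_integrable.1 ((Lp.memLp v).mono_exponent one_le_two)
  have hlim : Tendsto (fun n => eLpNorm (μ[f | F n] - ⇑v) 1 μ) atTop (𝓝 0) := by
    refine tendsto_eLpNorm_one_of_tendsto_eLpNorm one_le_two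
      (fun n => (integrable_condExp.sub hvi).1) ?_
    rw [Lp.tendsto_Lp_iff_tendsto_eLpNorm'] at hv
    refine hv.congr fun n => eLpNorm_congr_ae ?_
    exact (hf.condExpL2_ae_eq_condExp (𝕜 := ℝ) (hF n)).sub (ae_eq_refl _)
  have hvG : μ[f | ⨅ n, F n] =ᵐ[μ] v := by
    have hle : ∀ n, eLpNorm (μ[f | ⨅ n, F n] - ⇑v) 1 μ ≤ eLpNorm (μ[f | F n] - ⇑v) 1 μ := by
      intro n
      refine le_trans (le_of_eq (eLpNorm_congr_ae ?_))
        (eLpNorm_condExp_le_eLpNorm (m := ⨅ n, F n) _ le_rfl)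
      have h1 := condExp_condExp_of_le (f := f) (μ := μ) (iInf_le F n) (hF n)
      have h2 := condExp_of_aestronglyMeasurable' hG hvm hvi
      exact (h1.symm.sub h2.symm).trans (condExp_sub integrable_condExp hvi _).symm
    have h0 := le_antisymm (ge_of_tendsto' hlim hle) zero_le
    rw [eLpNorm_eq_zero_iff (integrable_condExp.sub hvi).1 one_ne_zero] at h0
    exact (sub_ae_eq_zero _ _).1 h0
  exact hlim.congr fun n => eLpNorm_congr_ae ((ae_eq_refl _).sub hvG.symm)

/-- Convergence in `L_p` of conditional expectations with respect to a monotone sequence of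
σ-algebras. -/
theorem MonotoneSigmaLimit.tendsto_eLpNorm_condExp (h : MonotoneSigmaLimit F G)
    (hF : ∀ n, F n ≤ m0) {p : ℝ≥0∞} (hp : 1 ≤ p) (hp_top : p ≠ ∞) {f : Ω → E} (hf : MemLp f p μ) :
    Tendsto (fun n => eLpNorm (μ[f | F n] - μ[f | G]) p μ) atTop (𝓝 0) := by
  have hint : ∀ {m m' : MeasurableSpace Ω} {g : Ω → E},
      AEStronglyMeasurable[m0] (μ[g | m] - μ[g | m']) μ :=
    (integrable_condExp.sub integrable_condExp).1
  refine tendsto_zero_of_tendsto_zero_indicator (μ := μ) hp_top (C := 2)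
    (N := fun n f => eLpNorm (μ[f | F n] - μ[f | G]) p μ) (by simp) ?_ ?_ ?_ hf
  · intro n f g hf hg
    have hf1 := hf.integrable hp
    have hg1 := hg.integrable hp
    refine le_trans (le_of_eq (eLpNorm_congr_ae ?_)) (eLpNorm_add_le hint hint hp)
    rw [← add_sub_add_comm]
    exact (condExp_add hf1 hg1 _).sub (condExp_add hf1 hg1 _)
  · intro n f hf
    refine (eLpNorm_sub_le integrable_condExp.1 integrable_condExp.1 hp).trans ?_
    rw [two_mul]
    exact add_le_add (eLpNorm_condExp_le_eLpNorm _ hp) (eLpNorm_condExp_le_eLpNorm _ hp)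
  · intro s hs c
    set φ : Ω → ℝ := s.indicator fun _ => (1 : ℝ) with hφ
    have hφ2 : MemLp φ 2 μ := memLp_indicator_const 2 hs 1 (Or.inr (measure_ne_top μ s))
    have hφ1 : Integrable φ μ := (integrable_const 1).indicator hs
    have hG := h.le hF
    have h1 : Tendsto (fun n => eLpNorm (μ[φ | F n] - μ[φ | G]) 1 μ) atTop (𝓝 0) := by
      rcases h with ⟨hm, rfl⟩ | ⟨ha, rfl⟩
      · exact MeasureTheory.tendsto_eLpNorm_condExp (ℱ := ⟨F, hm, hF⟩) φ
      · exact tendsto_eLpNorm_one_condExp_of_antitone hF ha hφ2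
    have h01 : ∀ m : MeasurableSpace Ω, m ≤ m0 →
        ∀ᵐ ω ∂μ, (μ[φ | m]) ω ∈ Set.Icc (0 : ℝ) 1 := fun m hm =>
      (convex_Icc (0 : ℝ) 1).condExp_mem hm hφ1 isClosed_Icc (ae_of_all _ fun ω => by
        by_cases hω : ω ∈ s <;> simp [hφ, hω])
    have h3 := tendsto_eLpNorm_of_enorm_le_one (p := p) hp hp_top (fun n => ?_) h1
    · have h4 := ENNReal.Tendsto.mul_const h3 (b := ‖c‖ₑ) (Or.inr enorm_ne_top)
      rw [zero_mul] at h4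
      refine h4.congr fun n => ?_
      rw [mul_comm, ← enorm_norm c, ← eLpNorm_const_smul]
      refine eLpNorm_congr_norm_ae ?_
      filter_upwards [condExp_indicator_const_ae_eq_smul (F n) hs c,
        condExp_indicator_const_ae_eq_smul G hs c] with ω h1 h2
      simp [h1, h2, ← sub_smul, norm_smul, mul_comm, hφ]
    · filter_upwards [h01 _ (hF n), h01 _ hG] with ω a b
      rw [← ofReal_norm, ← ENNReal.ofReal_one]
      refine ENNReal.ofReal_le_ofReal ?_
      rw [Pi.sub_apply, Real.norm_eq_abs, abs_le]
      constructor <;> linarith [a.1, a.2, b.1, b.2]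

/-- With `w = E(f | F N) - E(f | G)`, small in `L_1`, the error for `n ≥ N` equals `E(w | F n)`,
which the maximal inequality bounds. -/
theorem ae_tendsto_condExp_of_antitone (hF : ∀ n, F n ≤ m0) (hanti : Antitone F) {f : Ω → E}
    (hf : Integrable f μ) :
    ∀ᵐ ω ∂μ, Tendsto (fun n => (μ[f | F n]) ω) atTop (𝓝 ((μ[f | ⨅ n, F n]) ω)) := by
  have hlim := MonotoneSigmaLimit.tendsto_eLpNorm_condExp (Or.inr ⟨hanti, rfl⟩) hF le_rfl
    ENNReal.one_ne_top (memLp_one_iff_integrable.2 hf)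
  have hG : (⨅ n, F n) ≤ m0 := (iInf_le F 0).trans (hF 0)
  refine ae_tendsto_of_weak_bound fun ε hε => ?_
  obtain ⟨N, hN⟩ := (ENNReal.tendsto_nhds_zero.1 hlim ε (pos_iff_ne_zero.2 hε)).exists
  set w := μ[f | F N] - μ[f | ⨅ n, F n] with hw
  have hwi : Integrable w μ := integrable_condExp.sub integrable_condExp
  refine ⟨fun ω => ⨆ n, ‖(μ[w | F n]) ω‖ₑ, ?_, fun c hc =>
    (mul_measure_iSup_enorm_condExp_le_of_antitone hF hanti hwi hc).trans hN⟩
  have hall : ∀ᵐ ω ∂μ, ∀ n, N ≤ n →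
      (μ[w | F n]) ω = (μ[f | F n]) ω - (μ[f | ⨅ n, F n]) ω := by
    refine ae_all_iff.2 fun n => eventually_imp_distrib_left.2 fun hn => ?_
    have h1 := condExp_condExp_of_le (f := f) (μ := μ) (hanti hn) (hF N)
    have h2 : μ[μ[f | ⨅ n, F n] | F n] = μ[f | ⨅ n, F n] :=
      condExp_of_stronglyMeasurable (hF n) (stronglyMeasurable_condExp.mono (iInf_le F n))
        integrable_condExp
    filter_upwards [condExp_sub (μ := μ) (f := μ[f | F N]) (g := μ[f | ⨅ n, F n])
      integrable_condExp integrable_condExp (F n), h1] with ω e1 e2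
    rw [hw, e1, Pi.sub_apply, e2, h2]
  filter_upwards [hall] with ω hω δ _
  filter_upwards [eventually_ge_atTop N] with n hn
  rw [← hω n hn]
  exact (le_iSup (fun n => ‖(μ[w | F n]) ω‖ₑ) n).trans le_self_add

/-- For `n ≥ N` the error is `w - E(w | F n)`, where `w = E(f | F N) - E(f | G)`. Since `‖E(w | F
n)‖ ≤ E(‖w‖ | F n)`, the scalar Lévy theorem yields the eventual bound `E(‖w‖ | G) + ‖w‖`, of
integral at most `2‖w‖₁`. -/
theorem ae_tendsto_condExp_of_monotone (hF : ∀ n, F n ≤ m0) (hmono : Monotone F) {f : Ω → E}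
    (hf : Integrable f μ) :
    ∀ᵐ ω ∂μ, Tendsto (fun n => (μ[f | F n]) ω) atTop (𝓝 ((μ[f | ⨆ n, F n]) ω)) := by
  have hlim := MonotoneSigmaLimit.tendsto_eLpNorm_condExp (Or.inl ⟨hmono, rfl⟩) hF le_rfl
    ENNReal.one_ne_top (memLp_one_iff_integrable.2 hf)
  set G := ⨆ n, F n with hGdef
  have hG : G ≤ m0 := iSup_le hF
  refine ae_tendsto_of_weak_bound fun ε hε => ?_
  obtain ⟨N, hN⟩ := (ENNReal.tendsto_nhds_zero.1 hlim (ε / 2)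
    (ENNReal.half_pos hε)).exists
  set w := μ[f | F N] - μ[f | G] with hw
  have hwi : Integrable w μ := integrable_condExp.sub integrable_condExp
  refine ⟨fun ω => ‖(μ[fun x => ‖w x‖ | G]) ω‖ₑ + ‖w ω‖ₑ, ?_, fun c hc => ?_⟩
  · have hall : ∀ᵐ ω ∂μ, ∀ n, N ≤ n →
        (μ[w | F n]) ω = w ω - ((μ[f | F n]) ω - (μ[f | G]) ω) := by
      refine ae_all_iff.2 fun n => eventually_imp_distrib_left.2 fun hn => ?_
      have h1 : μ[μ[f | F N] | F n] = μ[f | F N] :=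
        condExp_of_stronglyMeasurable (hF n) (stronglyMeasurable_condExp.mono (hmono hn))
          integrable_condExp
      have h2 := condExp_condExp_of_le (f := f) (μ := μ) (le_iSup F n) hG
      filter_upwards [condExp_sub (μ := μ) (f := μ[f | F N]) (g := μ[f | G])
        integrable_condExp integrable_condExp (F n), h2] with ω e1 e2
      rw [hw, e1, Pi.sub_apply, Pi.sub_apply, e2, h1]
      abel
    have hscalar := MeasureTheory.tendsto_ae_condExp (μ := μ) (ℱ := ⟨F, hmono, hF⟩)
      (fun x => ‖w x‖)
    filter_upwards [hall, hscalar, ae_all_iff.2 fun n => norm_condExp_le (m := F n) (μ := μ) w]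
      with ω hω hsc hle δ hδ
    have hsc' := hsc.enorm
    have hlt : ∀ᶠ n in atTop, ‖(μ[fun x => ‖w x‖ | F n]) ω‖ₑ ≤
        ‖(μ[fun x => ‖w x‖ | G]) ω‖ₑ + δ :=
      (hsc'.eventually_lt_const (ENNReal.lt_add_right enorm_ne_top hδ)).mono fun n hn => hn.le
    filter_upwards [hlt, eventually_ge_atTop N] with n hn hnN
    have e : (μ[f | F n]) ω - (μ[f | G]) ω = w ω - (μ[w | F n]) ω := by
      rw [hω n hnN]
      abel
    have h3 : ‖(μ[w | F n]) ω‖ₑ ≤ ‖(μ[fun x => ‖w x‖ | F n]) ω‖ₑ :=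
      enorm_le_iff_norm_le.2 ((hle n).trans (Real.le_norm_self _))
    calc _ ≤ ‖w ω‖ₑ + ‖(μ[w | F n]) ω‖ₑ := by rw [e]; exact enorm_sub_le
      _ ≤ ‖w ω‖ₑ + (‖(μ[fun x => ‖w x‖ | G]) ω‖ₑ + δ) := by gcongr; exact h3.trans hn
      _ = _ := by rw [← add_assoc, add_comm ‖w ω‖ₑ]
  · have hAE : AEMeasurable (fun ω => ‖(μ[fun x => ‖w x‖ | G]) ω‖ₑ + ‖w ω‖ₑ) μ :=
      integrable_condExp.1.enorm.add hwi.1.enorm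
    have hsub : {ω | c < ‖(μ[fun x => ‖w x‖ | G]) ω‖ₑ + ‖w ω‖ₑ} ⊆
        {ω | c ≤ ‖(μ[fun x => ‖w x‖ | G]) ω‖ₑ + ‖w ω‖ₑ} := by
      intro ω hω
      rw [Set.mem_ofPred_eq] at hω ⊢
      exact hω.le
    refine le_trans (mul_le_mul_right (measure_mono hsub) _)
      ((mul_meas_ge_le_lintegral₀ hAE c).trans ?_)
    rw [lintegral_add_right' _ hwi.1.enorm, ← eLpNorm_one_eq_lintegral_enorm,
      ← eLpNorm_one_eq_lintegral_enorm, ← ENNReal.add_halves ε]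
    refine add_le_add ((eLpNorm_condExp_le_eLpNorm _ le_rfl).trans ?_) hN
    rwa [eLpNorm_norm]

/-- Almost everywhere convergence of conditional expectations with respect to a monotone sequence
of σ-algebras. -/
theorem MonotoneSigmaLimit.ae_tendsto_condExp (h : MonotoneSigmaLimit F G)
    (hF : ∀ n, F n ≤ m0) {f : Ω → E} (hf : Integrable f μ) :
    ∀ᵐ ω ∂μ, Tendsto (fun n => (μ[f | F n]) ω) atTop (𝓝 ((μ[f | G]) ω)) := by
  rcases h with ⟨hm, rfl⟩ | ⟨ha, rfl⟩
  · exact ae_tendsto_condExp_of_monotone hF hm hf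
  · exact ae_tendsto_condExp_of_antitone hF ha hf

end ConditionalExpectation

/-! ### Function and σ-algebra varying independently. -/

theorem aemeasurable_iSup_enorm_sub {Ω E : Type*} {m0 : MeasurableSpace Ω} {μ : Measure Ω}
    [NormedAddCommGroup E] {u : ℕ → Ω → E} {g : Ω → E} (hu : ∀ n, AEStronglyMeasurable (u n) μ)
    (hg : AEStronglyMeasurable g μ) (N : ℕ) :
    AEMeasurable (fun ω => ⨆ n, ‖u (n + N) ω - g ω‖ₑ) μ :=
  AEMeasurable.iSup fun n => ((hu (n + N)).sub hg).enorm

theorem tendsto_lintegral_iSup_enorm_sub {Ω E : Type*} {m0 : MeasurableSpace Ω} {μ : Measure Ω}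
    [NormedAddCommGroup E] {u : ℕ → Ω → E} {g : Ω → E} (hu : ∀ n, Integrable (u n) μ)
    (hg : Integrable g μ) (hlim : ∀ᵐ ω ∂μ, Tendsto (fun n => u n ω) atTop (𝓝 (g ω)))
    (hsup : ∫⁻ ω, ⨆ n, ‖u n ω‖ₑ ∂μ < ∞) :
    Tendsto (fun N => ∫⁻ ω, ⨆ n, ‖u (n + N) ω - g ω‖ₑ ∂μ) atTop (𝓝 0) := by
  set H : ℕ → Ω → ℝ≥0∞ := fun N ω => ⨆ n, ‖u (n + N) ω - g ω‖ₑ with hH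
  have hHm : ∀ N, AEMeasurable (H N) μ := fun N =>
    aemeasurable_iSup_enorm_sub (fun n => (hu n).1) hg.1 N
  have hbound : ∀ N ω, H N ω ≤ (⨆ n, ‖u n ω‖ₑ) + ‖g ω‖ₑ := fun N ω =>
    iSup_le fun n => enorm_sub_le.trans (by
      gcongr
      exact le_iSup (fun n => ‖u n ω‖ₑ) (n + N))
  have hfin : ∫⁻ ω, ((⨆ n, ‖u n ω‖ₑ) + ‖g ω‖ₑ) ∂μ ≠ ∞ := by
    rw [lintegral_add_right' _ hg.1.enorm]
    exact ENNReal.add_ne_top.2 ⟨hsup.ne, hg.2.ne⟩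
  have hH0 : ∀ᵐ ω ∂μ, Tendsto (fun N => H N ω) atTop (𝓝 0) := by
    filter_upwards [hlim] with ω hω
    rw [ENNReal.tendsto_nhds_zero]
    intro δ hδ
    have h1 := (hω.sub_const (g ω)).enorm
    rw [sub_self, enorm_zero] at h1
    obtain ⟨N, hN⟩ := eventually_atTop.1 (ENNReal.tendsto_nhds_zero.1 h1 δ hδ)
    filter_upwards [eventually_ge_atTop N] with k hk
    exact iSup_le fun n => hN _ (hk.trans (Nat.le_add_left k n))
  simpa using tendsto_lintegral_of_dominated_convergence' _ hHm
    (fun N => ae_of_all _ (hbound N)) hfin hH0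

/-- Dominated almost everywhere convergence of conditional expectations when the function and the
σ-algebra vary independently. -/
theorem MonotoneSigmaLimit.ae_tendsto_condExp_prod {Ω E : Type*} {m0 : MeasurableSpace Ω}
    {μ : Measure Ω} [IsFiniteMeasure μ] [NormedAddCommGroup E] [NormedSpace ℝ E] [CompleteSpace E]
    {F : ℕ → MeasurableSpace Ω} {G : MeasurableSpace Ω} (h : MonotoneSigmaLimit F G)
    (hF : ∀ n, F n ≤ m0) {u : ℕ → Ω → E} {g : Ω → E} (hu : ∀ n, Integrable (u n) μ)
    (hg : Integrable g μ) (hlim : ∀ᵐ ω ∂μ, Tendsto (fun n => u n ω) atTop (𝓝 (g ω)))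
    (hsup : ∫⁻ ω, ⨆ n, ‖u n ω‖ₑ ∂μ < ∞) :
    ∀ᵐ ω ∂μ, Tendsto (fun n : ℕ × ℕ => (μ[u n.1 | F n.2]) ω) (atTop ×ˢ atTop)
      (𝓝 ((μ[g | G]) ω)) := by
  set H : ℕ → Ω → ℝ≥0∞ := fun N ω => ⨆ n, ‖u (n + N) ω - g ω‖ₑ with hH
  have hHm : ∀ N, AEMeasurable (H N) μ := fun N =>
    aemeasurable_iSup_enorm_sub (fun n => (hu n).1) hg.1 N
  have hH0 : Tendsto (fun N => ∫⁻ ω, H N ω ∂μ) atTop (𝓝 0) :=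
    tendsto_lintegral_iSup_enorm_sub hu hg hlim hsup
  have hgF := h.ae_tendsto_condExp hF hg
  refine ae_tendsto_of_weak_bound fun ε hε => ?_
  -- For `ε = ∞` the bound `∫ H N ≤ ε` would not make `H N` integrable, so this case is settled
  -- trivially.
  rcases eq_or_ne ε ∞ with rfl | hεt
  · refine ⟨fun _ => ∞, ae_of_all _ fun ω δ _ => Eventually.of_forall fun _ => by simp,
      fun c _ => le_top⟩
  obtain ⟨N, hN⟩ := (ENNReal.tendsto_nhds_zero.1 hH0 ε (pos_iff_ne_zero.2 hε)).exists
  have hHfin : ∫⁻ ω, H N ω ∂μ ≠ ∞ := ne_top_of_le_ne_top hεt hN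
  -- `k` dominates `‖u n - g‖` for all `n ≥ N` at once, so `E(k | F m)` bounds the first part of the
  -- error uniformly in such `n`; it converges to `E(k | G)`, whose `L_1` norm is at most `ε`.
  set k : Ω → ℝ := fun ω => (H N ω).toReal with hk
  have hki : Integrable k μ := integrable_toReal_of_lintegral_ne_top (hHm N) hHfin
  have hdom : ∀ᵐ ω ∂μ, ∀ n m, N ≤ n →
      ‖(μ[u n | F m]) ω - (μ[g | F m]) ω‖ ≤ (μ[k | F m]) ω := by
    refine ae_all_iff.2 fun n => ae_all_iff.2 fun m => eventually_imp_distrib_left.2 fun hn => ?_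
    have hle : (fun ω => ‖(u n - g) ω‖) ≤ᵐ[μ] k := by
      filter_upwards [ae_lt_top' (hHm N) hHfin] with ω hω
      have h1 : ‖u n ω - g ω‖ₑ ≤ H N ω := by
        have := le_iSup (fun n => ‖u (n + N) ω - g ω‖ₑ) (n - N)
        rwa [Nat.sub_add_cancel hn] at this
      rw [← toReal_enorm]
      exact ENNReal.toReal_mono hω.ne h1
    filter_upwards [condExp_sub (hu n) hg (F m), norm_condExp_le (μ := μ) (m := F m) (u n - g),
      condExp_mono (m := F m) ((hu n).sub hg).norm hki hle] with ω e1 e2 e3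
    rw [e1] at e2
    exact e2.trans e3
  refine ⟨fun ω => ‖(μ[k | G]) ω‖ₑ, ?_, fun c _ => ?_⟩
  · filter_upwards [hdom, hgF, h.ae_tendsto_condExp hF hki] with ω hω hgω hkω δ hδ
    have hδ2 : δ / 2 ≠ 0 := (ENNReal.half_pos hδ).ne'
    have h1 : ∀ᶠ m in atTop, ‖(μ[k | F m]) ω‖ₑ ≤ ‖(μ[k | G]) ω‖ₑ + δ / 2 :=
      (hkω.enorm.eventually_lt_const (ENNReal.lt_add_right enorm_ne_top hδ2)).mono
        fun m hm => hm.le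
    have h2 := (hgω.sub_const ((μ[g | G]) ω)).enorm
    rw [sub_self, enorm_zero] at h2
    have h3 := h1.and (ENNReal.tendsto_nhds_zero.1 h2 (δ / 2) (pos_iff_ne_zero.2 hδ2))
    filter_upwards [(eventually_ge_atTop N).prod_mk h3] with n hn
    obtain ⟨hnN, hk1, hg1⟩ := hn
    have h4 : ‖(μ[u n.1 | F n.2]) ω - (μ[g | F n.2]) ω‖ₑ ≤ ‖(μ[k | F n.2]) ω‖ₑ :=
      enorm_le_iff_norm_le.2 ((hω n.1 n.2 hnN).trans (Real.le_norm_self _))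
    rw [← sub_add_sub_cancel _ ((μ[g | F n.2]) ω)]
    calc _ ≤ _ := enorm_add_le _ _
      _ ≤ (‖(μ[k | G]) ω‖ₑ + δ / 2) + δ / 2 := add_le_add (h4.trans hk1) hg1
      _ = _ := by rw [add_assoc, ENNReal.add_halves]
  · have hsub : {ω | c < ‖(μ[k | G]) ω‖ₑ} ⊆ {ω | c ≤ ‖(μ[k | G]) ω‖ₑ} := by
      intro ω hω
      rw [Set.mem_ofPred_eq] at hω ⊢
      exact hω.le
    refine le_trans (mul_le_mul_right (measure_mono hsub) _)
      ((mul_meas_ge_le_lintegral₀ integrable_condExp.1.enorm c).trans ?_)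
    rw [← eLpNorm_one_eq_lintegral_enorm]
    refine (eLpNorm_condExp_le_eLpNorm _ le_rfl).trans (le_trans ?_ hN)
    rw [eLpNorm_one_eq_lintegral_enorm]
    exact lintegral_mono fun ω => by
      rw [hk, Real.enorm_of_nonneg ENNReal.toReal_nonneg]
      exact ENNReal.ofReal_toReal_le

/-- Joint convergence in `L_p` of conditional expectations when the function and the σ-algebra
vary independently. -/
theorem MonotoneSigmaLimit.tendsto_eLpNorm_condExp_prod {Ω E : Type*} {m0 : MeasurableSpace Ω}
    {μ : Measure Ω} [IsFiniteMeasure μ] [NormedAddCommGroup E] [NormedSpace ℝ E] [CompleteSpace E]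
    {F : ℕ → MeasurableSpace Ω} {G : MeasurableSpace Ω} (h : MonotoneSigmaLimit F G)
    (hF : ∀ n, F n ≤ m0) {p : ℝ≥0∞} (hp : 1 ≤ p) (hp_top : p ≠ ∞) {u : ℕ → Ω → E} {g : Ω → E}
    (hu : ∀ n, MemLp (u n) p μ) (hg : MemLp g p μ)
    (hlim : Tendsto (fun n => eLpNorm (u n - g) p μ) atTop (𝓝 0)) :
    Tendsto (fun n : ℕ × ℕ => eLpNorm (μ[u n.1 | F n.2] - μ[g | G]) p μ)
      (atTop ×ˢ atTop) (𝓝 0) := by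
  have hsum := (hlim.comp tendsto_fst).add
    ((h.tendsto_eLpNorm_condExp hF hp hp_top hg).comp (tendsto_snd (f := atTop (α := ℕ))))
  rw [add_zero] at hsum
  refine tendsto_of_tendsto_of_tendsto_of_le_of_le tendsto_const_nhds hsum
    (fun _ => zero_le) (fun n => ?_)
  -- By contractivity the first difference is bounded independently of `n.2`, and the second does
  -- not involve `n.1`.
  rw [← sub_add_sub_cancel _ (μ[g | F n.2])]
  refine (eLpNorm_add_le (integrable_condExp.sub integrable_condExp).1
    (integrable_condExp.sub integrable_condExp).1 hp).trans (add_le_add ?_ le_rfl)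
  refine le_trans (le_of_eq (eLpNorm_congr_ae ?_)) (eLpNorm_condExp_le_eLpNorm (m := F n.2) _ hp)
  exact (condExp_sub ((hu n.1).integrable hp) (hg.integrable hp) _).symm

/-- For an endomorphism `τ` of a finite measure space, `birkhoffAverage ℝ τ f n` is
`S_n f = (1/n) ∑_{i<n} T^i f` with `T f = f ∘ τ` (it is `0` for `n = 0`, which affects neither
the limits nor the supremum of the norms). The function `fstar` is the limit of `S_n f`, both in
`L_p` and almost everywhere. -/
theorem theorem2p3 {Ω X : Type*} {m0 : MeasurableSpace Ω} (μ : Measure Ω) [IsFiniteMeasure μ]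
    [NormedAddCommGroup X] [NormedSpace ℝ X] [CompleteSpace X] (hX : IsReflexiveSpace X)
    (τ : Ω → Ω) (hτ : MeasurePreserving τ μ μ)
    (F : ℕ → MeasurableSpace Ω) (Finf : MeasurableSpace Ω)
    (hF : ∀ n, F n ≤ m0) (hFlim : MonotoneSigmaLimit F Finf)
    (p : ℝ≥0∞) (hp : 1 ≤ p) (hp_top : p ≠ ∞)
    (f : Ω → X) (hf : MemLp f p μ) :
    ∃ fstar : Ω → X,
      MemLp fstar p μ ∧
      Tendsto (fun n => eLpNorm (birkhoffAverage ℝ τ f n - fstar) p μ) atTop (𝓝 0) ∧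
      (∀ᵐ ω ∂μ, Tendsto (fun n => birkhoffAverage ℝ τ f n ω) atTop (𝓝 (fstar ω))) ∧
      -- part 1
      (Tendsto (fun n : ℕ × ℕ =>
          eLpNorm (μ[birkhoffAverage ℝ τ f n.1 | F n.2] - μ[fstar | Finf]) p μ)
          (atTop ×ˢ atTop) (𝓝 0) ∧
        eLpNorm (μ[fstar | Finf]) p μ ≤ eLpNorm f p μ) ∧
      -- part 2
      (∫⁻ ω, ⨆ n : ℕ, ‖birkhoffAverage ℝ τ f n ω‖ₑ ∂μ < ∞ →
        (∀ᵐ ω ∂μ, Tendsto (fun n : ℕ × ℕ => (μ[birkhoffAverage ℝ τ f n.1 | F n.2]) ω)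
          (atTop ×ˢ atTop) (𝓝 ((μ[fstar | Finf]) ω))) ∧
        Tendsto (fun n : ℕ × ℕ =>
          eLpNorm (μ[birkhoffAverage ℝ τ f n.1 | F n.2] - μ[fstar | Finf]) 1 μ)
          (atTop ×ˢ atTop) (𝓝 0) ∧
        ∫ ω, (μ[fstar | Finf]) ω ∂μ = ∫ ω, f ω ∂μ) := by
  obtain ⟨g, hg, hlim⟩ := exists_tendsto_eLpNorm_birkhoffAverage hτ hp hp_top hf
  have hA := fun n => hf.birkhoffAverage hτ n
  have hf1 : MemLp f 1 μ := hf.mono_exponent hp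
  have hg1 : MemLp g 1 μ := hg.mono_exponent hp
  have hA1 := fun n => hf1.birkhoffAverage hτ n
  have hlim1 := tendsto_eLpNorm_one_of_tendsto_eLpNorm hp (fun n => ((hA n).sub hg).1) hlim
  have hae := ae_tendsto_birkhoffAverage hτ hf1 hg1 hlim1
  refine ⟨g, hg, hlim, hae, ⟨hFlim.tendsto_eLpNorm_condExp_prod hF hp hp_top hA hg hlim, ?_⟩,
    fun hsup => ⟨hFlim.ae_tendsto_condExp_prod hF (fun n => memLp_one_iff_integrable.1 (hA1 n))
      (memLp_one_iff_integrable.1 hg1) hae hsup,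
      hFlim.tendsto_eLpNorm_condExp_prod hF le_rfl ENNReal.one_ne_top hA1 hg1 hlim1, ?_⟩⟩
  · refine (eLpNorm_condExp_le_eLpNorm g hp).trans ?_
    have hle : ∀ n, eLpNorm g p μ ≤ eLpNorm (birkhoffAverage ℝ τ f n - g) p μ + eLpNorm f p μ := by
      intro n
      have h1 : g = (g - birkhoffAverage ℝ τ f n) + birkhoffAverage ℝ τ f n := by abel
      conv_lhs => rw [h1]
      refine (eLpNorm_add_le (hg.sub (hA n)).1 (hA n).1 hp).trans (add_le_add ?_
        (eLpNorm_birkhoffAverage_le hτ hp hf.1 n))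
      rw [eLpNorm_sub_comm]
    simpa using ge_of_tendsto' (hlim.add_const (eLpNorm f p μ)) hle
  · rw [integral_condExp (hFlim.le hF)]
    have hint := tendsto_integral_of_L1' g hg1.1
      (Eventually.of_forall fun n => memLp_one_iff_integrable.1 (hA1 n)) hlim1
    refine tendsto_nhds_unique hint (tendsto_const_nhds.congr' ?_)
    filter_upwards [eventually_ne_atTop 0] with n hn
    exact (integral_birkhoffAverage hτ hf1 hn).symm
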